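/- Let $m,n\in\mathbb{N}$, let $A\in\mathbb{R}^{m\times m}$ be a matrix all of whose complex eigenvalues have strictly positive real part, let $\sigma\in\mathbb{R}^{m\times n}$, and let $B$ be a standard Brownian motion in $\mathbb{R}^n$. For $x\in\mathbb{R}^m$ let $X(x)=(X_t(x))_{t\ge 0}$ be the solution of $\mathrm{d}X_t(x)=-AX_t(x)\,\mathrm{d}t+\sigma\,\mathrm{d}B_t$, $X_0(x)=x$, and let $\mu$ be the stationary probability distribution of this equation, i.e. the probability measure on $\mathbb{R}^m$ with $\int \mathbb{P}(X_t(x)\in S)\,\mu(\mathrm{d}x)=\mu(S)$ for all $t\ge 0$ and all Borel sets $S\subset\mathbb{R}^m$. Put $$\Sigma_t:=\int_0^t e^{-As}\sigma\sigma^*e^{-A^*s}\,\mathrm{d}s,\qquad \Sigma_\infty:=\int_0^\infty e^{-As}\sigma\sigma^*e^{-A^*s}\,\mathrm{d}s .$$ Let $\mathcal{W}_2(\mu_1,\mu_2)=\big(\inf_{\mathcal{T}}\int|u-v|^2\,\mathcal{T}(\mathrm{d}u,\mathrm{d}v)\big)^{1/2}$, the infimum being over all couplings $\mathcal{T}$ of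 $\mu_1$ and $\mu_2$, where $|\cdot|$ is the Euclidean norm; a random variable as an argument of $\mathcal{W}_2$ stands for its law. Let $\|M\|=\big(\sum_{i,j}M_{i,j}^2\big)^{1/2}$ be the Frobenius norm, and let $\mathcal{N}(a,C)$ be the normal distribution with mean $a$ and covariance matrix $C$. Then for all $t\ge 0$ and $x\in\mathbb{R}^m$ $$\mathcal{W}_2(X_t(x),\mu)=\mathcal{W}_2\big(\mathcal{N}(e^{-At}x,\Sigma_t),\mathcal{N}(0,\Sigma_\infty)\big)\le\Big(|e^{-At}x|^2+\|\Sigma_t^{1/2}-\Sigma_\infty^{1/2}\|^2\Big)^{1/2},$$ and therefore also $$\mathcal{W}_2(X_t(x),\mu)\le\Big(|e^{-At}x|^2+m\|\Sigma_t^{1/2}-\Sigma_\infty^{1/2}\|^2\Big)^{1/2}.$$ If, in addition, $\Sigma_t$ commutes with $\Sigma_\infty$, then $$\mathcal{W}_2(X_t(x),\mu)=\Big(|e^{-At}x|^2+\|\Sigma_t^{1/2}-\Sigma_\infty^{1/2}\|^2\Big)^{1/2}.$$ -/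

import Mathlib

open MeasureTheory ProbabilityTheory
open scoped NNReal ENNReal Matrix MatrixOrder

noncomputable section

/-- `T` is a coupling of `μ₁` and `μ₂`: a measure on the product with these marginals. -/
def IsCoupling {E : Type*} [MeasurableSpace E] (μ₁ μ₂ : Measure E) (T : Measure (E × E)) : Prop :=
  (∀ S : Set E, MeasurableSet S → T (S ×ˢ Set.univ) = μ₁ S) ∧
    ∀ S : Set E, MeasurableSet S → T (Set.univ ×ˢ S) = μ₂ S

/-- The Wasserstein distance of order `p > 0`, with values in `[0, ∞]`:
`(inf_T ∫ |u - v|^p T(du, dv)) ^ min (1, 1 / p)` over all couplings `T`. -/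
def wasserstein {E : Type*} [NormedAddCommGroup E] [MeasurableSpace E]
    (p : ℝ) (μ₁ μ₂ : Measure E) : ℝ≥0∞ :=
  (⨅ (T : Measure (E × E)) (_ : IsCoupling μ₁ μ₂ T), ∫⁻ z, ‖z.1 - z.2‖ₑ ^ p ∂T) ^ min 1 (1 / p)

/-- All complex eigenvalues of the real matrix `A` have strictly positive real part. -/
def HasPositiveSpectrum {m : ℕ} (A : Matrix (Fin m) (Fin m) ℝ) : Prop :=
  ∀ z ∈ spectrum ℂ (A.map (algebraMap ℝ ℂ)), 0 < z.re

/-- Standard Brownian motion in `ℝⁿ`: the coordinates are independent standard real Brownian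
motions. -/
structure IsStdBrownian {Ω : Type*} [MeasurableSpace Ω] {n : ℕ}
    (B : ℝ≥0 → Ω → EuclideanSpace ℝ (Fin n)) (P : Measure Ω) : Prop where
  coord : ∀ i, IsBrownianReal (fun t ω ↦ B t ω i) P
  indep : iIndepFun (fun i ω t ↦ B t ω i) P

/-- `X` is a solution of `dX = -A X dt + σ dB`, `X₀ = x`: a process with almost surely continuous
paths such that almost surely `X_t = x - ∫₀ᵗ A X_s ds + σ B_t` for all `t ≥ 0`. The dispersion
matrix is constant and `B` starts in `0`, so `∫₀ᵗ σ dB_s = σ B_t`. -/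
structure IsOUSolution {Ω : Type*} [MeasurableSpace Ω] {m n : ℕ}
    (A : Matrix (Fin m) (Fin m) ℝ) (σ : Matrix (Fin m) (Fin n) ℝ)
    (B : ℝ≥0 → Ω → EuclideanSpace ℝ (Fin n)) (P : Measure Ω) (x : EuclideanSpace ℝ (Fin m))
    (X : ℝ≥0 → Ω → EuclideanSpace ℝ (Fin m)) : Prop where
  aemeasurable : ∀ t, AEMeasurable (X t) P
  continuous_paths : ∀ᵐ ω ∂P, Continuous fun t ↦ X t ω
  equation : ∀ᵐ ω ∂P, ∀ t : ℝ≥0,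
    X t ω = x - (∫ s in (0 : ℝ)..t, A.toEuclideanLin (X s.toNNReal ω)) + σ.toEuclideanLin (B t ω)

/-- `μ` is stationary for the dynamics `x ↦ X(x)`: when the initial state is distributed according
to `μ`, the state at each time `t` is distributed according to `μ`. -/
def IsStationaryLaw {Ω : Type*} [MeasurableSpace Ω] {m : ℕ} (P : Measure Ω)
    (X : EuclideanSpace ℝ (Fin m) → ℝ≥0 → Ω → EuclideanSpace ℝ (Fin m))
    (μ : Measure (EuclideanSpace ℝ (Fin m))) : Prop :=
  ∀ (t : ℝ≥0) (S : Set (EuclideanSpace ℝ (Fin m))), MeasurableSet S →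
    ∫⁻ x, P.map (X x t) S ∂μ = μ S

/-- `e^{-At}`. -/
def expNeg {m : ℕ} (A : Matrix (Fin m) (Fin m) ℝ) (t : ℝ) : Matrix (Fin m) (Fin m) ℝ :=
  NormedSpace.exp (-t • A)

/-- `Σ_t = ∫₀ᵗ e^{-As} σ σ* e^{-A*s} ds`, entrywise. -/
def covAt {m n : ℕ} (A : Matrix (Fin m) (Fin m) ℝ) (σ : Matrix (Fin m) (Fin n) ℝ) (t : ℝ) :
    Matrix (Fin m) (Fin m) ℝ :=
  Matrix.of fun i j ↦ ∫ s in (0 : ℝ)..t, (expNeg A s * σ * σᵀ * expNeg Aᵀ s) i j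

/-- `Σ_∞ = ∫₀^∞ e^{-As} σ σ* e^{-A*s} ds`, entrywise. -/
def covInfty {m n : ℕ} (A : Matrix (Fin m) (Fin m) ℝ) (σ : Matrix (Fin m) (Fin n) ℝ) :
    Matrix (Fin m) (Fin m) ℝ :=
  Matrix.of fun i j ↦ ∫ s in Set.Ioi (0 : ℝ), (expNeg A s * σ * σᵀ * expNeg Aᵀ s) i j

/-- The square of the Frobenius norm. -/
def frobeniusSq {m n : ℕ} (M : Matrix (Fin m) (Fin n) ℝ) : ℝ :=
  ∑ i, ∑ j, M i j ^ 2

end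

/-! The two laws are first identified as Gaussian; the rest is optimal transport between Gaussians.

Law of `X_t`: fix `v` and let `h s = e^{-A*(t-s)} v`, which solves the adjoint equation `h' = A* h`.
Pairing `h` with the solution cancels the drift, so `⟪v, X_t⟫ - ⟪v, e^{-At} x⟫` is, path by path,
the limit of the Riemann–Stieltjes sums of `⟪σ* h, dB⟫` (`tendsto_sum_inner_increment`). No
stochastic integral is needed: the sums have explicit Gaussian characteristic functions, and
dominated convergence gives that of `N(e^{-At} x, Σ_t)` (`IsOUSolution.map_eq`).

Stationary law: stationarity says that `μ` is the convolution of its image under `e^{-At}` with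
`N(0, Σ_t)`. The positive spectrum makes `e^{-At}` decay exponentially, so `t → ∞` in the
characteristic functions forces `μ = N(0, Σ_∞)`.

Transport: driving both Gaussians by one standard Gaussian vector gives a coupling whose cost is the
upper bound. If the covariances commute, their roots share an orthonormal eigenbasis. Along each
basis vector every coupling costs at least the squared difference of means plus the squared
difference of standard deviations, and these add up to the same value. -/

/-! ### Cauchy–Schwarz and Minkowski for variances -/

section Variance

variable {Ω : Type*} [MeasurableSpace Ω] {μ : Measure Ω} [IsProbabilityMeasure μ] {f g : Ω → ℝ}

lemma variance_mul_sub (hf : MemLp f 2 μ) (hg : MemLp g 2 μ) (c : ℝ) :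
    variance (fun ω ↦ c * f ω - g ω) μ =
      c ^ 2 * variance f μ - 2 * c * covariance f g μ + variance g μ := by
  rw [variance_fun_sub (hf.const_mul c) hg, variance_const_mul, covariance_const_mul_left]
  ring

/-- The variance of `c f - g` is a nonnegative quadratic polynomial in `c`, so its discriminant is
nonpositive. Degenerate variances need no separate case. -/
lemma covariance_le_of_variance_eq_sq (hf : MemLp f 2 μ) (hg : MemLp g 2 μ) {r s : ℝ}
    (hr : 0 ≤ r) (hs : 0 ≤ s) (hfr : variance f μ = r ^ 2) (hgs : variance g μ = s ^ 2) :
    covariance f g μ ≤ r * s := by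
  have key : discrim (r ^ 2) (-2 * covariance f g μ) (s ^ 2) ≤ 0 := by
    refine discrim_le_zero fun c ↦ ?_
    have := variance_nonneg (fun ω ↦ c * f ω - g ω) μ
    rw [variance_mul_sub hf hg, hfr, hgs] at this
    linarith
  rw [discrim] at key
  exact abs_le_of_sq_le_sq' (by nlinarith) (by positivity) |>.2

/-- Minkowski's inequality for standard deviations, in squared form. -/
lemma sq_sub_le_variance_sub (hf : MemLp f 2 μ) (hg : MemLp g 2 μ) {r s : ℝ}
    (hr : 0 ≤ r) (hs : 0 ≤ s) (hfr : variance f μ = r ^ 2) (hgs : variance g μ = s ^ 2) :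
    (r - s) ^ 2 ≤ variance (fun ω ↦ f ω - g ω) μ := by
  have h := variance_mul_sub hf hg 1
  simp only [one_mul] at h
  have := covariance_le_of_variance_eq_sq hf hg hr hs hfr hgs
  rw [h, hfr, hgs]
  nlinarith

lemma lintegral_ofReal_sq (hf : MemLp f 2 μ) :
    ∫⁻ ω, ENNReal.ofReal (f ω ^ 2) ∂μ = ENNReal.ofReal ((∫ ω, f ω ∂μ) ^ 2 + variance f μ) := by
  rw [← ofReal_integral_eq_lintegral_ofReal hf.integrable_sq (ae_of_all _ fun _ ↦ sq_nonneg _),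
    variance_eq_sub hf]
  simp

end Variance

/-! ### Gaussian second moments, the Frobenius norm, common eigenbases -/

section Euclidean

open scoped RealInnerProductSpace

variable {E : Type*} [NormedAddCommGroup E] [InnerProductSpace ℝ E] {ι : Type*} [Fintype ι]

lemma OrthonormalBasis.enorm_rpow_two_eq_sum (b : OrthonormalBasis ι ℝ E) (x : E) :
    ‖x‖ₑ ^ (2 : ℝ) = ∑ i, ENNReal.ofReal (⟪b i, x⟫ ^ 2) := by
  rw [← ENNReal.ofReal_sum_of_nonneg (fun _ _ ↦ sq_nonneg _), b.sum_sq_inner_right,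
    ENNReal.rpow_two, ← ofReal_norm, ENNReal.ofReal_pow (norm_nonneg _)]

lemma lintegral_inner_add_stdGaussian [FiniteDimensional ℝ E] [MeasurableSpace E] [BorelSpace E]
    (r : ℝ) (w : E) :
    ∫⁻ z, ENNReal.ofReal ((r + ⟪w, z⟫) ^ 2) ∂(stdGaussian E) =
      ENNReal.ofReal (r ^ 2 + ‖w‖ ^ 2) := by
  have hL : MemLp (fun z : E ↦ ⟪w, z⟫) 2 (stdGaussian E) :=
    IsGaussian.memLp_dual _ (innerSL ℝ w) _ (by simp)
  have hc : MemLp (fun z : E ↦ r + ⟪w, z⟫) 2 (stdGaussian E) := (memLp_const r).add hL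
  have hm : ∫ z, ⟪w, z⟫ ∂(stdGaussian E) = 0 := integral_strongDual_stdGaussian (innerSL ℝ w)
  have hv : variance (fun z : E ↦ ⟪w, z⟫) (stdGaussian E) = ‖w‖ ^ 2 := by
    rw [← innerSL_apply_norm ℝ w]
    exact variance_dual_stdGaussian (innerSL ℝ w)
  rw [lintegral_ofReal_sq hc, variance_const_add hL.1, hv, integral_add (integrable_const _)
    (hL.integrable (by simp)), hm]
  simp

/-- Parseval reduces the integral to one-dimensional marginals `⟪T* bᵢ, z⟫`, which are centred with
variance `‖T* bᵢ‖²`. This is the cost of the coupling by common noise. -/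
lemma lintegral_enorm_add_stdGaussian [FiniteDimensional ℝ E] [MeasurableSpace E] [BorelSpace E]
    (b : OrthonormalBasis ι ℝ E) (c : E) (T : E →L[ℝ] E) :
    ∫⁻ z, ‖c + T z‖ₑ ^ (2 : ℝ) ∂(stdGaussian E) =
      ENNReal.ofReal (‖c‖ ^ 2 + ∑ i, ‖T.adjoint (b i)‖ ^ 2) := by
  simp_rw [b.enorm_rpow_two_eq_sum, inner_add_right, ← ContinuousLinearMap.adjoint_inner_left]
  rw [lintegral_finsetSum _ (fun i _ ↦ by fun_prop), ← b.sum_sq_inner_right,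
    ← Finset.sum_add_distrib, ENNReal.ofReal_sum_of_nonneg (fun _ _ ↦ by positivity)]
  exact Finset.sum_congr rfl fun i _ ↦ lintegral_inner_add_stdGaussian _ _

/-- The Hilbert–Schmidt norm does not depend on the basis: apply Parseval twice and exchange the
sums. The lower bound needs it in an eigenbasis. -/
lemma frobeniusSq_eq_sum {m : ℕ} (M : Matrix (Fin m) (Fin m) ℝ)
    (b : OrthonormalBasis ι ℝ (EuclideanSpace ℝ (Fin m))) :
    frobeniusSq M = ∑ i, ‖(Matrix.toEuclideanCLM (𝕜 := ℝ) M).adjoint (b i)‖ ^ 2 := by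
  set T := Matrix.toEuclideanCLM (𝕜 := ℝ) M
  let e := EuclideanSpace.basisFun (Fin m) ℝ
  calc frobeniusSq M = ∑ j, ‖T (e j)‖ ^ 2 := by
        rw [frobeniusSq, Finset.sum_comm]
        simp [EuclideanSpace.real_norm_sq_eq, T, e]
    _ = ∑ j, ∑ i, ⟪b i, T (e j)⟫ ^ 2 := by simp_rw [b.sum_sq_inner_right]
    _ = ∑ i, ∑ j, ⟪T.adjoint (b i), e j⟫ ^ 2 := by
        rw [Finset.sum_comm]
        simp_rw [ContinuousLinearMap.adjoint_inner_left]
    _ = _ := by simp_rw [e.sum_sq_inner_left]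

lemma frobeniusSq_nonneg {m n : ℕ} (M : Matrix (Fin m) (Fin n) ℝ) : 0 ≤ frobeniusSq M :=
  Finset.sum_nonneg fun _ _ ↦ Finset.sum_nonneg fun _ _ ↦ sq_nonneg _

/-- Two commuting symmetric operators have a common orthonormal eigenbasis. -/
lemma LinearMap.IsSymmetric.exists_orthonormalBasis_of_commute [FiniteDimensional ℝ E]
    {S T : E →ₗ[ℝ] E} (hS : S.IsSymmetric) (hT : T.IsSymmetric) (h : Commute S T) :
    ∃ (b : OrthonormalBasis (Fin (Module.finrank ℝ E)) ℝ E) (s t : Fin (Module.finrank ℝ E) → ℝ),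
      ∀ i, S (b i) = s i • b i ∧ T (b i) = t i • b i := by
  classical
  let V := fun i : ℝ × ℝ ↦ Module.End.eigenspace S i.2 ⊓ Module.End.eigenspace T i.1
  have hI : DirectSum.IsInternal V := hS.directSum_isInternal_of_commute hT h
  have hO : OrthogonalFamily ℝ (fun i ↦ V i) fun i ↦ (V i).subtypeₗᵢ :=
    LinearMap.IsSymmetric.orthogonalFamily_eigenspace_inf_eigenspace hS hT
  let J := {i // V i ≠ ⊥}
  have : Fintype J := hI.submodule_iSupIndep.fintypeNeBotOfFiniteDimensional
  have hI' : DirectSum.IsInternal fun j : J ↦ V j := (DirectSum.isInternal_ne_bot_iff).2 hI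
  have hO' : OrthogonalFamily ℝ (fun j : J ↦ V j) fun j ↦ (V j).subtypeₗᵢ :=
    hO.comp Subtype.val_injective
  refine ⟨hI'.subordinateOrthonormalBasis rfl hO',
    fun i ↦ (hI'.subordinateOrthonormalBasisIndex rfl i hO').1.2,
    fun i ↦ (hI'.subordinateOrthonormalBasisIndex rfl i hO').1.1, fun i ↦ ?_⟩
  have := hI'.subordinateOrthonormalBasis_subordinate rfl i hO'
  rw [Submodule.mem_inf, Module.End.mem_eigenspace_iff, Module.End.mem_eigenspace_iff] at this
  exact this

end Euclidean

/-! ### Quadratic transport between Gaussian measures -/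

section Wasserstein

open scoped RealInnerProductSpace

lemma wasserstein_two_eq {E : Type*} [NormedAddCommGroup E] [MeasurableSpace E]
    (μ₁ μ₂ : Measure E) :
    wasserstein 2 μ₁ μ₂ = (⨅ (T : Measure (E × E)) (_ : IsCoupling μ₁ μ₂ T),
      ∫⁻ z, ‖z.1 - z.2‖ₑ ^ (2 : ℝ) ∂T) ^ (1 / 2 : ℝ) := by
  rw [wasserstein, min_eq_right (by norm_num)]

lemma ENNReal.ofReal_sqrt_eq_rpow {r : ℝ} (hr : 0 ≤ r) :
    ENNReal.ofReal (√r) = ENNReal.ofReal r ^ (1 / 2 : ℝ) := by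
  rw [Real.sqrt_eq_rpow, ENNReal.ofReal_rpow_of_nonneg hr (by norm_num)]

lemma IsCoupling.map_fst {E : Type*} [MeasurableSpace E] {μ₁ μ₂ : Measure E}
    {T : Measure (E × E)} (hT : IsCoupling μ₁ μ₂ T) : T.map Prod.fst = μ₁ := by
  ext S hS
  rw [Measure.map_apply measurable_fst hS, ← hT.1 S hS, Set.prod_univ]

lemma IsCoupling.map_snd {E : Type*} [MeasurableSpace E] {μ₁ μ₂ : Measure E}
    {T : Measure (E × E)} (hT : IsCoupling μ₁ μ₂ T) : T.map Prod.snd = μ₂ := by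
  ext S hS
  rw [Measure.map_apply measurable_snd hS, ← hT.2 S hS, Set.univ_prod]

variable {m : ℕ} (a b : EuclideanSpace ℝ (Fin m)) (S T : Matrix (Fin m) (Fin m) ℝ)

theorem wasserstein_multivariateGaussian_le :
    wasserstein 2 (multivariateGaussian a S) (multivariateGaussian b T) ≤
      ENNReal.ofReal (√(‖a - b‖ ^ 2 + frobeniusSq (CFC.sqrt S - CFC.sqrt T))) := by
  rw [wasserstein_two_eq, ENNReal.ofReal_sqrt_eq_rpow
    (add_nonneg (sq_nonneg _) (frobeniusSq_nonneg _))]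
  gcongr
  let R := Matrix.toEuclideanCLM (𝕜 := ℝ) (CFC.sqrt S)
  let Q := Matrix.toEuclideanCLM (𝕜 := ℝ) (CFC.sqrt T)
  have hm : Measurable fun z ↦ (a + R z, b + Q z) := by fun_prop
  -- The coupling uses the same standard Gaussian vector `z` for both marginals.
  have hc : IsCoupling (multivariateGaussian a S) (multivariateGaussian b T)
      ((stdGaussian (EuclideanSpace ℝ (Fin m))).map fun z ↦ (a + R z, b + Q z)) := by
    refine ⟨fun A hA ↦ ?_, fun A hA ↦ ?_⟩
    · rw [multivariateGaussian, Measure.map_apply hm (hA.prod .univ),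
        Measure.map_apply (by fun_prop) hA]
      congr 1
      ext z
      simp [R]
    · rw [multivariateGaussian, Measure.map_apply hm (.prod .univ hA),
        Measure.map_apply (by fun_prop) hA]
      congr 1
      ext z
      simp [Q]
  refine (iInf₂_le _ hc).trans_eq ?_
  rw [lintegral_map (by fun_prop) hm,
    frobeniusSq_eq_sum _ (EuclideanSpace.basisFun (Fin m) ℝ),
    ← lintegral_enorm_add_stdGaussian (EuclideanSpace.basisFun (Fin m) ℝ)]
  refine lintegral_congr fun z ↦ ?_
  congr 2
  simp only [map_sub, sub_apply, R, Q]
  abel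

variable {S T}

/-- Writing `S` as the square of its self-adjoint root turns the variance `⟪e, S e⟫` into `⟪√S e, √S
e⟫ = r²`. -/
lemma variance_inner_multivariateGaussian (hS : S.PosSemidef) {e : EuclideanSpace ℝ (Fin m)}
    {r : ℝ} (he : ‖e‖ = 1) (hr : Matrix.toEuclideanCLM (𝕜 := ℝ) (CFC.sqrt S) e = r • e) :
    variance (fun u ↦ ⟪e, u⟫) (multivariateGaussian a S) = r ^ 2 := by
  have hsa : IsSelfAdjoint (Matrix.toEuclideanCLM (𝕜 := ℝ) (CFC.sqrt S)) :=
    (CFC.sqrt_nonneg S).isSelfAdjoint.map _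
  rw [← covarianceBilin_self IsGaussian.memLp_two_id, covarianceBilin_multivariateGaussian hS,
    ← Matrix.inner_toEuclideanCLM]
  nth_rw 1 [← CFC.sqrt_mul_sqrt_self S hS.nonneg]
  rw [map_mul, mul_apply_eq_comp, ← ContinuousLinearMap.adjoint_inner_left,
    hsa.adjoint_eq, hr, inner_smul_left, inner_smul_right, real_inner_self_eq_norm_sq, he]
  simp [sq]

lemma Matrix.PosSemidef.nonneg_of_apply_eq_smul {R : Matrix (Fin m) (Fin m) ℝ}
    (hR : R.PosSemidef) {e : EuclideanSpace ℝ (Fin m)} {r : ℝ} (he : ‖e‖ = 1)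
    (hr : Matrix.toEuclideanCLM (𝕜 := ℝ) R e = r • e) : 0 ≤ r := by
  have h := hR.dotProduct_mulVec_nonneg e
  rw [star_trivial, ← Matrix.inner_toEuclideanCLM, hr, inner_smul_right,
    real_inner_self_eq_norm_sq, he] at h
  simpa using h

theorem wasserstein_multivariateGaussian_eq_of_commute (hS : S.PosSemidef) (hT : T.PosSemidef)
    (h : Commute S T) :
    wasserstein 2 (multivariateGaussian a S) (multivariateGaussian b T) =
      ENNReal.ofReal (√(‖a - b‖ ^ 2 + frobeniusSq (CFC.sqrt S - CFC.sqrt T))) := by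
  refine le_antisymm (wasserstein_multivariateGaussian_le a b S T) ?_
  rw [wasserstein_two_eq, ENNReal.ofReal_sqrt_eq_rpow
    (add_nonneg (sq_nonneg _) (frobeniusSq_nonneg _))]
  gcongr
  refine le_iInf₂ fun γ hγ ↦ ?_
  have hRp : (CFC.sqrt S).PosSemidef := Matrix.nonneg_iff_posSemidef.1 (CFC.sqrt_nonneg S)
  have hQp : (CFC.sqrt T).PosSemidef := Matrix.nonneg_iff_posSemidef.1 (CFC.sqrt_nonneg T)
  -- Square roots come from the functional calculus, so they inherit commutation from `S` and `T`.
  have hcomm : Commute (CFC.sqrt S) (CFC.sqrt T) :=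
    ((h.cfcₙ_nnreal _).symm.cfcₙ_nnreal _).symm
  obtain ⟨e, r, q, he⟩ := LinearMap.IsSymmetric.exists_orthonormalBasis_of_commute
    (Matrix.isSymmetric_toEuclideanLin_iff.2 hRp.1) (Matrix.isSymmetric_toEuclideanLin_iff.2 hQp.1)
    (LinearMap.ext fun z ↦ DFunLike.congr_fun
      (hcomm.map (Matrix.toEuclideanCLM (𝕜 := ℝ) (n := Fin m))).eq z)
  have hr i : Matrix.toEuclideanCLM (𝕜 := ℝ) (CFC.sqrt S) (e i) = r i • e i := (he i).1
  have hq i : Matrix.toEuclideanCLM (𝕜 := ℝ) (CFC.sqrt T) (e i) = q i • e i := (he i).2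
  have hsa : IsSelfAdjoint (Matrix.toEuclideanCLM (𝕜 := ℝ) (CFC.sqrt S - CFC.sqrt T)) :=
    ((CFC.sqrt_nonneg S).isSelfAdjoint.sub (CFC.sqrt_nonneg T).isSelfAdjoint).map _
  have hγ1 : MeasurePreserving Prod.fst γ (multivariateGaussian a S) :=
    ⟨measurable_fst, hγ.map_fst⟩
  have hγ2 : MeasurePreserving Prod.snd γ (multivariateGaussian b T) :=
    ⟨measurable_snd, hγ.map_snd⟩
  have : IsProbabilityMeasure γ := by
    rw [← Measure.isProbabilityMeasure_map_iff measurable_fst.aemeasurable, hγ.map_fst]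
    infer_instance
  simp_rw [e.enorm_rpow_two_eq_sum]
  rw [lintegral_finsetSum _ (fun i _ ↦ by fun_prop), frobeniusSq_eq_sum _ e, hsa.adjoint_eq,
    ← e.sum_sq_inner_right, ← Finset.sum_add_distrib,
    ENNReal.ofReal_sum_of_nonneg (fun _ _ ↦ by positivity)]
  -- Both sides are now sums over the common eigenbasis. In direction `e i` the cost is the squared
  -- mean plus the variance of a difference of variables with standard deviations `r i` and `q i`.
  refine Finset.sum_le_sum fun i _ ↦ ?_
  have hL (c U) : MemLp (fun u ↦ ⟪e i, u⟫) 2 (multivariateGaussian c U) :=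
    IsGaussian.memLp_dual _ (innerSL ℝ (e i)) _ (by simp)
  have hm (c U) : ∫ u, ⟪e i, u⟫ ∂(multivariateGaussian c U) = ⟪e i, c⟫ := by
    have := (innerSL ℝ (e i)).integral_comp_id_comm (μ := multivariateGaussian c U)
      IsGaussian.integrable_id
    simpa using this
  have hf : MemLp (fun z : _ × _ ↦ ⟪e i, z.1⟫) 2 γ := (hL a S).comp_measurePreserving hγ1
  have hg : MemLp (fun z : _ × _ ↦ ⟪e i, z.2⟫) 2 γ := (hL b T).comp_measurePreserving hγ2
  have hfm : ∫ z, ⟪e i, z.1⟫ ∂γ = ⟪e i, a⟫ := by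
    rw [← hm a S, ← hγ.map_fst, integral_map (by fun_prop) (by fun_prop)]
  have hgm : ∫ z, ⟪e i, z.2⟫ ∂γ = ⟪e i, b⟫ := by
    rw [← hm b T, ← hγ.map_snd, integral_map (by fun_prop) (by fun_prop)]
  have hfv : variance (fun z : _ × _ ↦ ⟪e i, z.1⟫) γ = r i ^ 2 := by
    rw [← variance_inner_multivariateGaussian a hS (e.norm_eq_one i) (hr i), ← hγ.map_fst,
      variance_map (by fun_prop) (by fun_prop)]
    rfl
  have hgv : variance (fun z : _ × _ ↦ ⟪e i, z.2⟫) γ = q i ^ 2 := by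
    rw [← variance_inner_multivariateGaussian b hT (e.norm_eq_one i) (hq i), ← hγ.map_snd,
      variance_map (by fun_prop) (by fun_prop)]
    rfl
  simp_rw [inner_sub_right]
  have hfg : MemLp (fun z : _ × _ ↦ ⟪e i, z.1⟫ - ⟪e i, z.2⟫) 2 γ := hf.sub hg
  rw [lintegral_ofReal_sq hfg, integral_sub (hf.integrable (by simp))
    (hg.integrable (by simp)), hfm, hgm, map_sub, sub_apply, hr, hq,
    ← sub_smul, norm_smul, e.norm_eq_one, mul_one, Real.norm_eq_abs, sq_abs]
  gcongr
  exact sq_sub_le_variance_sub hf hg (hRp.nonneg_of_apply_eq_smul (e.norm_eq_one i) (hr i))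
    (hQp.nonneg_of_apply_eq_smul (e.norm_eq_one i) (hq i)) hfv hgv

end Wasserstein

/-! ### Exponential decay of `e^{-At}` -/

section Decay

/-- A continuous semigroup which contracts at some positive time decays exponentially. -/
lemma exists_norm_le_mul_exp_of_norm_lt_one {𝔸 : Type*} [NormedRing 𝔸] {U : ℝ → 𝔸}
    (hU : Continuous U) (hadd : ∀ s t, U (s + t) = U s * U t) {T : ℝ} (hT : 0 < T)
    (hUT : ‖U T‖ < 1) :
    ∃ C c : ℝ, 0 < c ∧ ∀ t, 0 ≤ t → ‖U t‖ ≤ C * Real.exp (-c * t) := by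
  -- Since `‖U T‖` may be zero, `q` is kept above `1/2` so that `log q` and `q⁻¹` make sense.
  obtain ⟨q, hq, hq1⟩ := exists_between (max_lt hUT one_half_lt_one)
  have hq0 : 0 < q := one_half_pos.trans (max_lt_iff.1 hq).2
  have hUq : ‖U T‖ ≤ q := (max_lt_iff.1 hq).1.le
  obtain ⟨K, hK⟩ := isCompact_Icc (a := (0 : ℝ)) (b := T).exists_bound_of_continuousOn
    hU.continuousOn
  have hK0 : 0 ≤ K := (norm_nonneg _).trans (hK 0 ⟨le_rfl, hT.le⟩)
  have hmul (k : ℕ) (s : ℝ) : ‖U (k * T + s)‖ ≤ q ^ k * ‖U s‖ := by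
    induction k with
    | zero => simp
    | succ k ih =>
      rw [show ((k + 1 : ℕ) : ℝ) * T + s = T + (k * T + s) by push_cast; ring, hadd, pow_succ',
        mul_assoc]
      exact (norm_mul_le _ _).trans (by gcongr)
  -- The rate is chosen so that `e^{-ct} = q^(t/T)`; the factor `q⁻¹` pays for `⌊t/T⌋ > t/T - 1`.
  refine ⟨K * q⁻¹, -Real.log q / T, div_pos (neg_pos.2 (Real.log_neg hq0 hq1)) hT, fun t ht ↦ ?_⟩
  set k := ⌊t / T⌋₊
  have hk1 : (k : ℝ) * T ≤ t := (le_div_iff₀ hT).1 (Nat.floor_le (by positivity))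
  have hk2 : t / T < k + 1 := Nat.lt_floor_add_one _
  have hk3 : t < (k + 1) * T := (div_lt_iff₀ hT).1 hk2
  calc ‖U t‖ = ‖U (k * T + (t - k * T))‖ := by ring_nf
    _ ≤ q ^ k * K := (hmul _ _).trans (by gcongr; exact hK _ ⟨by linarith, by linarith⟩)
    _ ≤ (q⁻¹ * q ^ (t / T)) * K := by
      gcongr
      rw [← Real.rpow_natCast, ← Real.rpow_neg_one, ← Real.rpow_add hq0]
      exact Real.rpow_le_rpow_of_exponent_ge hq0 hq1.le (by linarith)
    _ = _ := by
      rw [Real.rpow_def_of_pos hq0,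
        show -(-Real.log q / T) * t = Real.log q * (t / T) by field_simp]
      ring

attribute [local instance] Matrix.linftyOpNormedRing Matrix.linftyOpNormedAlgebra

variable {m : ℕ}

lemma Matrix.exp_mulVec_of_mulVec_eq_smul {M : Matrix (Fin m) (Fin m) ℂ} {w : Fin m → ℂ} {z : ℂ}
    (h : M *ᵥ w = z • w) : NormedSpace.exp M *ᵥ w = Complex.exp z • w := by
  have hpow (n : ℕ) : (M ^ n) *ᵥ w = z ^ n • w := by
    induction n with
    | zero => simp
    | succ n ih => rw [pow_succ, ← Matrix.mulVec_mulVec, h, Matrix.mulVec_smul, ih, smul_smul,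
        pow_succ']
  have h1 := (NormedSpace.exp_series_hasSum_exp' (𝕂 := ℂ) M).map
    (⟨⟨fun N : Matrix (Fin m) (Fin m) ℂ ↦ N *ᵥ w, Matrix.zero_mulVec w⟩,
      fun N N' ↦ Matrix.add_mulVec N N' w⟩ : Matrix (Fin m) (Fin m) ℂ →+ (Fin m → ℂ))
    (by change Continuous fun N : Matrix (Fin m) (Fin m) ℂ ↦ N *ᵥ w; fun_prop)
  have h2 := (NormedSpace.exp_series_hasSum_exp' (𝕂 := ℂ) z).smul_const w
  rw [← Complex.exp_eq_exp_ℂ] at h2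
  refine HasSum.unique (f := fun n : ℕ ↦ ((n.factorial : ℂ)⁻¹ • z ^ n) • w) ?_ h2
  convert h1 using 2 with n
  · simp [Matrix.smul_mulVec, hpow, smul_smul]
  · rfl

/-- The spectral mapping theorem for the exponential of a matrix, nontrivial inclusion. -/
lemma Matrix.exists_exp_eq_of_mem_spectrum_exp {M : Matrix (Fin m) (Fin m) ℂ} {l : ℂ}
    (hl : l ∈ spectrum ℂ (NormedSpace.exp M)) : ∃ z ∈ spectrum ℂ M, Complex.exp z = l := by
  rw [← Matrix.spectrum_toLin', ← Module.End.hasEigenvalue_iff_mem_spectrum] at hl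
  set W := Module.End.eigenspace (NormedSpace.exp M).toLin' l
  have hcomm : Commute (NormedSpace.exp M).toLin' M.toLin' := by
    have h : Commute (NormedSpace.exp M) M := (Commute.refl M).exp_left
    rw [Commute, SemiconjBy, Module.End.mul_eq_comp, Module.End.mul_eq_comp,
      ← Matrix.toLin'_mul, ← Matrix.toLin'_mul, h.eq]
  -- `M` commutes with its exponential, hence preserves the eigenspace `W`; over `ℂ` it has an
  -- eigenvector there, which the exponential scales by both `e^z` and `l`.
  have hmaps : ∀ w ∈ W, M.toLin' w ∈ W := Module.End.mapsTo_genEigenspace_of_comm hcomm l 1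
  have : Nontrivial W := Submodule.nontrivial_iff_ne_bot.2 hl
  obtain ⟨z, hz⟩ := Module.End.exists_eigenvalue (M.toLin'.restrict hmaps)
  obtain ⟨w, hw⟩ := hz.exists_hasEigenvector
  have hMw : M.toLin' w = z • (w : Fin m → ℂ) := congrArg Subtype.val hw.apply_eq_smul
  have hw0 : (w : Fin m → ℂ) ≠ 0 := by simpa using hw.2
  refine ⟨z, ?_, ?_⟩
  · rw [← Matrix.spectrum_toLin', ← Module.End.hasEigenvalue_iff_mem_spectrum]
    exact Module.End.hasEigenvalue_of_hasEigenvector ⟨Module.End.mem_eigenspace_iff.2 hMw, hw0⟩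
  · have h1 : NormedSpace.exp M *ᵥ (w : Fin m → ℂ) = l • (w : Fin m → ℂ) :=
      Module.End.mem_eigenspace_iff.1 w.2
    rw [Matrix.exp_mulVec_of_mulVec_eq_smul hMw] at h1
    exact smul_left_injective ℂ hw0 h1

lemma expNeg_add (A : Matrix (Fin m) (Fin m) ℝ) (s t : ℝ) :
    expNeg A (s + t) = expNeg A s * expNeg A t := by
  rw [expNeg, neg_add, add_smul, Matrix.exp_add_of_commute]
  · rfl
  · exact ((Commute.refl A).smul_left _).smul_right _

lemma expNeg_transpose (A : Matrix (Fin m) (Fin m) ℝ) (t : ℝ) :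
    expNeg Aᵀ t = (expNeg A t)ᵀ := by
  rw [expNeg, expNeg, ← Matrix.exp_transpose, Matrix.transpose_smul]

lemma hasDerivAt_expNeg (A : Matrix (Fin m) (Fin m) ℝ) (t : ℝ) :
    HasDerivAt (expNeg A) (-(A * expNeg A t)) t := by
  have hA : expNeg A = fun u ↦ NormedSpace.exp (u • -A) := by
    funext u
    rw [expNeg, smul_neg, neg_smul]
  rw [hA, ← neg_mul]
  exact hasDerivAt_exp_smul_const' (𝕂 := ℝ) (-A) t

lemma continuous_expNeg (A : Matrix (Fin m) (Fin m) ℝ) : Continuous (expNeg A) :=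
  continuous_iff_continuousAt.2 fun t ↦ (hasDerivAt_expNeg A t).continuousAt

lemma map_ofReal_expNeg (A : Matrix (Fin m) (Fin m) ℝ) (n : ℕ) :
    (expNeg A n).map (algebraMap ℝ ℂ) = NormedSpace.exp (-A.map (algebraMap ℝ ℂ)) ^ n := by
  have hc : Continuous ((algebraMap ℝ ℂ).mapMatrix (m := Fin m)) := by
    refine continuous_matrix fun i j ↦ ?_
    exact Complex.continuous_ofReal.comp (continuous_id.matrix_elem i j)
  have hA : (algebraMap ℝ ℂ).mapMatrix (-(n : ℝ) • A) = n • -A.map (algebraMap ℝ ℂ) := by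
    ext i j
    simp
  rw [← Matrix.exp_nsmul, ← hA]
  exact NormedSpace.map_exp (algebraMap ℝ ℂ).mapMatrix hc (-(n : ℝ) • A)

lemma spectralRadius_exp_neg_lt_one {A : Matrix (Fin m) (Fin m) ℝ} (hA : HasPositiveSpectrum A) :
    spectralRadius ℂ (NormedSpace.exp (-A.map (algebraMap ℝ ℂ))) < 1 := by
  rcases (spectrum ℂ (NormedSpace.exp (-A.map (algebraMap ℝ ℂ)))).eq_empty_or_nonempty with h | h
  · rw [spectralRadius, h]
    simp
  · refine spectrum.spectralRadius_lt_of_forall_lt_of_nonempty h fun l hl ↦ ?_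
    obtain ⟨z, hz, rfl⟩ := Matrix.exists_exp_eq_of_mem_spectrum_exp hl
    have := hA (-z) (by rwa [← Set.mem_neg, spectrum.neg_eq])
    rw [← NNReal.coe_lt_coe, coe_nnnorm, Complex.norm_exp]
    simpa using this

/-- By Gelfand's formula a spectral radius below one gives a power of `e^{-A}` of norm below one,
that is, a contraction at a positive integer time. -/
lemma exists_norm_expNeg_le {A : Matrix (Fin m) (Fin m) ℝ} (hA : HasPositiveSpectrum A) :
    ∃ C c : ℝ, 0 < c ∧ ∀ t, 0 ≤ t → ‖expNeg A t‖ ≤ C * Real.exp (-c * t) := by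
  set a := NormedSpace.exp (-A.map (algebraMap ℝ ℂ))
  have h := (spectrum.pow_nnnorm_pow_one_div_tendsto_nhds_spectralRadius a).eventually_lt_const
    (spectralRadius_exp_neg_lt_one hA)
  obtain ⟨n, hn, hn0⟩ := (h.and (Filter.eventually_gt_atTop 0)).exists
  refine exists_norm_le_mul_exp_of_norm_lt_one (continuous_expNeg A) (expNeg_add A)
    (T := n) (by exact_mod_cast hn0) ?_
  have h1 : ‖a ^ n‖ < 1 := by
    by_contra! hge
    refine hn.not_ge (ENNReal.one_le_rpow ?_ (by positivity))
    exact_mod_cast hge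
  rw [← map_ofReal_expNeg] at h1
  -- The maximal absolute row sum is unchanged by the entrywise embedding of `ℝ` into `ℂ`.
  simpa [Matrix.linfty_opNorm_def] using h1

lemma Matrix.abs_apply_le_linfty_opNorm (M : Matrix (Fin m) (Fin m) ℝ) (i j : Fin m) :
    |M i j| ≤ ‖M‖ := by
  rw [← Real.norm_eq_abs, ← coe_nnnorm, ← coe_nnnorm, NNReal.coe_le_coe,
    Matrix.linfty_opNNNorm_def]
  exact (Finset.single_le_sum (f := fun j ↦ ‖M i j‖₊) (fun _ _ ↦ zero_le)
    (Finset.mem_univ j)).trans (Finset.le_sup (f := fun i ↦ ∑ j, ‖M i j‖₊) (Finset.mem_univ i))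

end Decay

/-! ### Riemann and Riemann–Stieltjes sums on uniform partitions -/

section Partition

open Filter Topology
open scoped RealInnerProductSpace

lemma natCast_mul_div_mem_Icc {t : ℝ} (ht : 0 ≤ t) {k N : ℕ} (hk : k ≤ N) :
    (k : ℝ) * (t / N) ∈ Set.Icc 0 t := by
  refine ⟨by positivity, ?_⟩
  rcases N.eq_zero_or_pos with rfl | hN
  · simpa using ht
  · calc (k : ℝ) * (t / N) ≤ N * (t / N) := by gcongr
      _ = t := by field_simp

lemma natCast_succ_mul_sub (k : ℕ) (d : ℝ) : ((k + 1 : ℕ) : ℝ) * d - k * d = d := by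
  push_cast; ring

lemma natCast_mul_le_succ_mul {t : ℝ} (ht : 0 ≤ t) (k N : ℕ) :
    (k : ℝ) * (t / N) ≤ ((k + 1 : ℕ) : ℝ) * (t / N) := by
  have := natCast_succ_mul_sub k (t / N)
  have : 0 ≤ t / N := by positivity
  linarith

/-- Integrals over the cells of uniform partitions of functions that are uniformly small. -/
lemma tendsto_sum_integral_cell_zero {t : ℝ} (ht : 0 ≤ t) {H : ℕ → ℕ → ℝ → ℝ}
    (hH : ∀ ε > 0, ∀ᶠ N : ℕ in atTop, ∀ k < N,
      ∀ s ∈ Set.Icc ((k : ℝ) * (t / N)) (((k + 1 : ℕ) : ℝ) * (t / N)), |H N k s| ≤ ε) :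
    Tendsto (fun N : ℕ ↦ ∑ k ∈ Finset.range N,
      ∫ s in ((k : ℝ) * (t / N))..(((k + 1 : ℕ) : ℝ) * (t / N)), H N k s) atTop (𝓝 0) := by
  rw [Metric.tendsto_nhds]
  intro ε hε
  -- Dividing by `t + 1` instead of `t` keeps the bound strict and covers `t = 0`.
  filter_upwards [hH (ε / (t + 1)) (by positivity)] with N hN
  rw [dist_zero_right]
  calc _ ≤ ∑ k ∈ Finset.range N, ε / (t + 1) * (t / N) := by
        refine norm_sum_le_of_le _ fun k hk ↦ ?_
        have h := intervalIntegral.norm_integral_le_of_norm_le_const (f := H N k)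
          (a := (k : ℝ) * (t / N)) (b := ((k + 1 : ℕ) : ℝ) * (t / N)) (C := ε / (t + 1))
          (fun s hs ↦ by
            rw [Set.uIoc_of_le (natCast_mul_le_succ_mul ht k N)] at hs
            exact hN k (Finset.mem_range.1 hk) s ⟨hs.1.le, hs.2⟩)
        rwa [natCast_succ_mul_sub, abs_of_nonneg (by positivity : 0 ≤ t / N)] at h
    _ = ε / (t + 1) * (N * (t / N)) := by
        rw [Finset.sum_const, Finset.card_range, nsmul_eq_mul]; ring
    _ ≤ ε / (t + 1) * t := by
        gcongr
        exact (natCast_mul_div_mem_Icc ht le_rfl).2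
    _ < ε := by
        rw [div_mul_eq_mul_div, div_lt_iff₀ (by positivity)]
        nlinarith

lemma eventually_div_natCast_lt (t : ℝ) {δ : ℝ} (hδ : 0 < δ) : ∀ᶠ N : ℕ in atTop, t / N < δ :=
  (tendsto_const_div_atTop_nhds_zero_nat t).eventually_lt_const hδ

/-- A jointly continuous function is evaluated at two pairs of points that lie in the closure of
the same cell of the partition. -/
lemma eventually_abs_sub_le_of_mem_cell {t : ℝ} (ht : 0 ≤ t) {G : ℝ → ℝ → ℝ}
    (hG : Continuous fun p : ℝ × ℝ ↦ G p.1 p.2) {ε : ℝ} (hε : 0 < ε) :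
    ∀ᶠ N : ℕ in atTop, ∀ k < N,
      ∀ s ∈ Set.Icc ((k : ℝ) * (t / N)) (((k + 1 : ℕ) : ℝ) * (t / N)),
        |G s (((k + 1 : ℕ) : ℝ) * (t / N)) - G ((k : ℝ) * (t / N)) s| ≤ ε := by
  have hu := (isCompact_Icc.prod isCompact_Icc).uniformContinuousOn_of_continuous
    (hG.continuousOn (s := Set.Icc 0 t ×ˢ Set.Icc 0 t))
  obtain ⟨δ, hδ, h⟩ := Metric.uniformContinuousOn_iff.1 hu ε hε
  filter_upwards [eventually_div_natCast_lt t hδ] with N hN k hk s hs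
  have h1 := natCast_mul_div_mem_Icc ht hk.le
  have h2 := natCast_mul_div_mem_Icc ht (Nat.succ_le_of_lt hk)
  have hst : s ∈ Set.Icc 0 t := ⟨h1.1.trans hs.1, hs.2.trans h2.2⟩
  have hd := natCast_succ_mul_sub k (t / N)
  refine (h (s, _) ⟨hst, h2⟩ (_, s) ⟨h1, hst⟩ ?_).le
  rw [Prod.dist_eq, max_lt_iff, Real.dist_eq, Real.dist_eq, abs_of_nonneg (by linarith [hs.1]),
    abs_of_nonneg (by linarith [hs.2])]
  constructor <;> linarith [hs.1, hs.2]

lemma tendsto_riemannSum {t : ℝ} (ht : 0 ≤ t) {f : ℝ → ℝ} (hf : Continuous f) :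
    Tendsto (fun N : ℕ ↦ ∑ k ∈ Finset.range N, t / N * f (k * (t / N))) atTop
      (𝓝 (∫ s in (0 : ℝ)..t, f s)) := by
  have h := tendsto_sum_integral_cell_zero ht (H := fun N k s ↦ f s - f (k * (t / N)))
    fun ε hε ↦ eventually_abs_sub_le_of_mem_cell ht (G := fun s _ ↦ f s) (by fun_prop) hε
  have h' := h.const_sub (∫ s in (0 : ℝ)..t, f s)
  rw [sub_zero] at h'
  refine h'.congr' ?_
  filter_upwards [eventually_gt_atTop 0] with N hN
  have hsum := intervalIntegral.sum_integral_adjacent_intervals (f := f) (μ := volume)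
    (a := fun k : ℕ ↦ (k : ℝ) * (t / N)) (n := N) fun k _ ↦ hf.intervalIntegrable _ _
  have hN0 : (N : ℝ) ≠ 0 := by positivity
  simp only [Nat.cast_zero, zero_mul, mul_div_cancel₀ _ hN0] at hsum
  rw [← hsum, ← Finset.sum_sub_distrib]
  refine Finset.sum_congr rfl fun k _ ↦ ?_
  rw [intervalIntegral.integral_sub (hf.intervalIntegrable _ _) (by simp),
    intervalIntegral.integral_const, natCast_succ_mul_sub, smul_eq_mul]
  ring

variable {E : Type*} [NormedAddCommGroup E] [InnerProductSpace ℝ E] [CompleteSpace E]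

/-- Summation by parts on one cell: the left side is `⟪h b - h a, Y b⟫ + ⟪h a, Y b - Y a - (W b - W
a)⟫`. The adjoint equation and the equation for `Y` turn these into integrals that nearly cancel on
a short cell, whatever the variation of `W`. -/
lemma inner_sub_inner_sub_inner_increment {Y W h : ℝ → E} {L : E →L[ℝ] E} {x : E}
    (hY : Continuous Y) (hh : ∀ s, HasDerivAt h (L.adjoint (h s)) s)
    (heq : ∀ s, 0 ≤ s → Y s = x - (∫ r in (0 : ℝ)..s, L (Y r)) + W s) {a b : ℝ} (ha : 0 ≤ a)
    (hb : 0 ≤ b) :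
    ⟪h b, Y b⟫ - ⟪h a, Y a⟫ - ⟪h a, W b - W a⟫ =
      ∫ s in a..b, (⟪h s, L (Y b)⟫ - ⟪h a, L (Y s)⟫) := by
  have hc : Continuous h := continuous_iff_continuousAt.2 fun s ↦ (hh s).continuousAt
  have hLY : Continuous fun s ↦ L (Y s) := by fun_prop
  have h1 : ∫ s in a..b, ⟪h s, L (Y b)⟫ = ⟪h b, Y b⟫ - ⟪h a, Y b⟫ := by
    refine intervalIntegral.integral_eq_sub_of_hasDerivAt (f := fun s ↦ ⟪h s, Y b⟫)
      (fun s _ ↦ ?_) (Continuous.intervalIntegrable (by fun_prop) _ _)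
    have := (hh s).inner ℝ (hasDerivAt_const s (Y b))
    rwa [inner_zero_right, zero_add, ContinuousLinearMap.adjoint_inner_left] at this
  have h2 : ∫ s in a..b, ⟪h a, L (Y s)⟫ = ⟪h a, ∫ s in a..b, L (Y s)⟫ :=
    (innerSL ℝ (h a)).intervalIntegral_comp_comm (hLY.intervalIntegrable _ _)
  have h3 : Y b - Y a = -(∫ s in a..b, L (Y s)) + (W b - W a) := by
    have := intervalIntegral.integral_interval_sub_left (a := 0) (b := b) (c := a) (μ := volume)
      (hLY.intervalIntegrable _ _) (hLY.intervalIntegrable _ _)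
    rw [heq b hb, heq a ha, ← this]
    abel
  have h4 : ⟪h a, Y b⟫ - ⟪h a, Y a⟫ =
      -⟪h a, ∫ s in a..b, L (Y s)⟫ + ⟪h a, W b - W a⟫ := by
    rw [← inner_sub_right, h3, inner_add_right, inner_neg_right]
  rw [intervalIntegral.integral_sub (Continuous.intervalIntegrable (by fun_prop) _ _)
    (Continuous.intervalIntegrable (by fun_prop) _ _), h1, h2]
  linarith

/-- The integral of a solution `h` of the adjoint equation against the driving path of a linear
equation with additive forcing, as a limit of Riemann–Stieltjes sums. -/
theorem tendsto_sum_inner_increment {Y W h : ℝ → E} {L : E →L[ℝ] E} {x : E}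
    (hY : Continuous Y) (hh : ∀ s, HasDerivAt h (L.adjoint (h s)) s)
    (heq : ∀ s, 0 ≤ s → Y s = x - (∫ r in (0 : ℝ)..s, L (Y r)) + W s) {t : ℝ} (ht : 0 ≤ t) :
    Tendsto (fun N : ℕ ↦ ∑ k ∈ Finset.range N,
      ⟪h (k * (t / N)), W (((k + 1 : ℕ) : ℝ) * (t / N)) - W (k * (t / N))⟫) atTop
      (𝓝 (⟪h t, Y t⟫ - ⟪h 0, Y 0⟫)) := by
  have hc : Continuous h := continuous_iff_continuousAt.2 fun s ↦ (hh s).continuousAt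
  have hlim := tendsto_sum_integral_cell_zero ht
    (H := fun N k s ↦ ⟪h s, L (Y (((k + 1 : ℕ) : ℝ) * (t / N)))⟫ - ⟪h (k * (t / N)), L (Y s)⟫)
    fun ε hε ↦ eventually_abs_sub_le_of_mem_cell ht (G := fun a b ↦ ⟪h a, L (Y b)⟫)
      (by fun_prop) hε
  have hlim' := hlim.const_sub (⟪h t, Y t⟫ - ⟪h 0, Y 0⟫)
  rw [sub_zero] at hlim'
  refine hlim'.congr' ?_
  filter_upwards [eventually_gt_atTop 0] with N hN
  have hN0 : (N : ℝ) ≠ 0 := by positivity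
  have htel := Finset.sum_range_sub
    (fun k : ℕ ↦ ⟪h ((k : ℝ) * (t / N)), Y ((k : ℝ) * (t / N))⟫) N
  simp only [Nat.cast_zero, zero_mul, mul_div_cancel₀ _ hN0] at htel
  rw [← htel, ← Finset.sum_sub_distrib]
  refine Finset.sum_congr rfl fun k _ ↦ ?_
  rw [← inner_sub_inner_sub_inner_increment hY hh heq (by positivity) (by positivity)]
  ring

end Partition

/-! ### Characteristic functions of Wiener integrals of step functions -/

section WienerSum

open scoped RealInnerProductSpace

variable {Ω : Type*} [MeasurableSpace Ω] {P : Measure Ω}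

lemma ProbabilityTheory.IsBrownianReal.map_increment {b : ℝ≥0 → Ω → ℝ} (hb : IsBrownianReal b P)
    {s t : ℝ≥0} (h : s ≤ t) : P.map (fun ω ↦ b t ω - b s ω) = gaussianReal 0 (t - s) := by
  have hd : nndist t s = t - s := by
    rw [NNReal.nndist_eq, tsub_eq_zero_of_le h, max_eq_left zero_le]
  rw [← hd]
  exact (hb.hasLaw_sub t s).map_eq

/-- Independence of the increments factors the characteristic function. Evaluation at `1` suffices,
because the coefficients `c` absorb the frequency. -/
lemma charFun_map_sum_mul_increment [IsProbabilityMeasure P] {b : ℝ≥0 → Ω → ℝ}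
    (hb : IsBrownianReal b P) {τ : ℕ → ℝ≥0} (hτ : Monotone τ) (c : ℕ → ℝ) (N : ℕ) :
    charFun (P.map fun ω ↦ ∑ k ∈ Finset.range N, c k * (b (τ (k + 1)) ω - b (τ k) ω)) 1 =
      Complex.exp (-((∑ k ∈ Finset.range N, ((τ (k + 1) : ℝ) - τ k) * c k ^ 2 : ℝ) : ℂ) / 2) := by
  have hm (k : ℕ) : AEMeasurable (fun ω ↦ c k * (b (τ (k + 1)) ω - b (τ k) ω)) P :=
    ((hb.aemeasurable _).sub (hb.aemeasurable _)).const_mul _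
  have hind := (hb.hasIndepIncrements.nat hτ).comp (fun k y ↦ c k * y) (fun k ↦ by fun_prop)
  rw [iIndepFun.charFun_map_fun_finsetSum_eq_prod
    (X := fun k ω ↦ c k * (b (τ (k + 1)) ω - b (τ k) ω)) (fun k _ ↦ hm k) (hind.restrict _),
    Finset.prod_apply, Complex.ofReal_sum, ← Finset.sum_neg_distrib, Finset.sum_div,
    Complex.exp_sum]
  refine Finset.prod_congr rfl fun k _ ↦ ?_
  rw [charFun_map_mul_comp (f := fun ω ↦ b (τ (k + 1)) ω - b (τ k) ω)
      ((hb.aemeasurable _).sub (hb.aemeasurable _)),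
    hb.map_increment (hτ k.le_succ), charFun_gaussianReal, NNReal.coe_sub (hτ k.le_succ)]
  congr 1
  push_cast
  ring

variable {n : ℕ} {B : ℝ≥0 → Ω → EuclideanSpace ℝ (Fin n)}

lemma IsStdBrownian.aemeasurable (hB : IsStdBrownian B P) (t : ℝ≥0) : AEMeasurable (B t) P :=
  (MeasurableEquiv.toLp 2 (Fin n → ℝ)).measurable.comp_aemeasurable
    (aemeasurable_pi_lambda (fun ω i ↦ B t ω i) fun i ↦ (hB.coord i).aemeasurable t)

lemma IsStdBrownian.ae_eval_zero (hB : IsStdBrownian B P) : ∀ᵐ ω ∂P, B 0 ω = 0 := by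
  filter_upwards [ae_all_iff.2 fun i ↦ (hB.coord i).eval_zero_ae_eq_zero] with ω hω
  ext i
  exact hω i

/-- The characteristic function of the Wiener integral of a step function. -/
theorem IsStdBrownian.integral_exp_sum_inner_increment [IsProbabilityMeasure P]
    (hB : IsStdBrownian B P) {τ : ℕ → ℝ≥0} (hτ : Monotone τ) (g : ℕ → EuclideanSpace ℝ (Fin n))
    (N : ℕ) :
    ∫ ω, Complex.exp (((∑ k ∈ Finset.range N, ⟪g k, B (τ (k + 1)) ω - B (τ k) ω⟫ : ℝ) : ℂ) *
        Complex.I) ∂P =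
      Complex.exp
        (-((∑ k ∈ Finset.range N, ((τ (k + 1) : ℝ) - τ k) * ‖g k‖ ^ 2 : ℝ) : ℂ) / 2) := by
  let S (i : Fin n) (ω : Ω) : ℝ :=
    ∑ k ∈ Finset.range N, g k i * (B (τ (k + 1)) ω i - B (τ k) ω i)
  have hS (i : Fin n) : AEMeasurable (S i) P :=
    Finset.aemeasurable_fun_sum _ fun k _ ↦ (((hB.coord i).aemeasurable _).sub
      ((hB.coord i).aemeasurable _)).const_mul _
  have hind : iIndepFun S P := hB.indep.comp
    (fun i w ↦ ∑ k ∈ Finset.range N, g k i * (w (τ (k + 1)) - w (τ k))) (fun i ↦ by fun_prop)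
  have hsum (ω : Ω) : ∑ k ∈ Finset.range N, ⟪g k, B (τ (k + 1)) ω - B (τ k) ω⟫ = ∑ i, S i ω := by
    rw [Finset.sum_comm]
    simp [PiLp.inner_apply, mul_comm]
  have hm : AEMeasurable (fun ω ↦ ∑ i, S i ω) P := Finset.aemeasurable_fun_sum _ fun i _ ↦ hS i
  simp_rw [hsum]
  have h1 := charFun_apply_real (μ := P.map fun ω ↦ ∑ i, S i ω) 1
  rw [integral_map hm (by fun_prop)] at h1
  simp only [Complex.ofReal_one, one_mul] at h1
  rw [← h1, hind.charFun_map_fun_sum_eq_prod hS, Finset.prod_apply]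
  simp_rw [S, charFun_map_sum_mul_increment (hB.coord _) hτ]
  rw [← Complex.exp_sum, ← Finset.sum_div, Finset.sum_neg_distrib, ← Complex.ofReal_sum,
    Finset.sum_comm]
  simp_rw [EuclideanSpace.real_norm_sq_eq, Finset.mul_sum]

end WienerSum

/-! ### Covariance matrices as integrals of Gram matrices -/

section Covariance

open Filter Topology
open scoped RealInnerProductSpace

variable {m n : ℕ}

lemma dotProduct_of_integral_mulVec {ν : Measure ℝ} {M : ℝ → Matrix (Fin m) (Fin m) ℝ}
    (hM : ∀ i j, Integrable (fun s ↦ M s i j) ν) (v : Fin m → ℝ) :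
    v ⬝ᵥ (Matrix.of fun i j ↦ ∫ s, M s i j ∂ν) *ᵥ v = ∫ s, v ⬝ᵥ M s *ᵥ v ∂ν := by
  simp only [dotProduct, Matrix.mulVec, Matrix.of_apply, Finset.mul_sum]
  rw [integral_finsetSum _ fun i _ ↦ integrable_finsetSum _ fun j _ ↦
    ((hM i j).mul_const _).const_mul _]
  refine Finset.sum_congr rfl fun i _ ↦ ?_
  rw [integral_finsetSum _ fun j _ ↦ ((hM i j).mul_const _).const_mul _]
  refine Finset.sum_congr rfl fun j _ ↦ ?_
  rw [integral_const_mul, integral_mul_const]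

lemma Matrix.PosSemidef.of_integral {ν : Measure ℝ} {M : ℝ → Matrix (Fin m) (Fin m) ℝ}
    (hM : ∀ i j, Integrable (fun s ↦ M s i j) ν) (hp : ∀ s, (M s).PosSemidef) :
    (Matrix.of fun i j ↦ ∫ s, M s i j ∂ν).PosSemidef := by
  refine .of_dotProduct_mulVec_nonneg ?_ fun v ↦ ?_
  · ext i j
    simp only [Matrix.conjTranspose_apply, Matrix.of_apply, star_trivial]
    refine integral_congr_ae (ae_of_all _ fun s ↦ ?_)
    simpa using (hp s).1.apply i j
  · rw [star_trivial, dotProduct_of_integral_mulVec hM]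
    exact integral_nonneg fun s ↦ by simpa using (hp s).dotProduct_mulVec_nonneg v

variable (A : Matrix (Fin m) (Fin m) ℝ) (σ : Matrix (Fin m) (Fin n) ℝ)

/-- The Gram form gives both positive semidefiniteness and the quadratic form as a squared norm. -/
lemma covDensity_eq (s : ℝ) :
    expNeg A s * σ * σᵀ * expNeg Aᵀ s = (σᵀ * expNeg Aᵀ s)ᵀ * (σᵀ * expNeg Aᵀ s) := by
  rw [Matrix.transpose_mul, Matrix.transpose_transpose, expNeg_transpose,
    Matrix.transpose_transpose]
  simp only [Matrix.mul_assoc]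

lemma posSemidef_covDensity (s : ℝ) : (expNeg A s * σ * σᵀ * expNeg Aᵀ s).PosSemidef := by
  rw [covDensity_eq]
  exact Matrix.posSemidef_conjTranspose_mul_self (σᵀ * expNeg Aᵀ s)

lemma dotProduct_covDensity_mulVec (s : ℝ) (v : EuclideanSpace ℝ (Fin m)) :
    v ⬝ᵥ (expNeg A s * σ * σᵀ * expNeg Aᵀ s) *ᵥ v =
      ‖(σᵀ * expNeg Aᵀ s).toEuclideanLin v‖ ^ 2 := by
  rw [covDensity_eq, ← Matrix.mulVec_mulVec, Matrix.dotProduct_mulVec, Matrix.vecMul_transpose,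
    EuclideanSpace.real_norm_sq_eq]
  simp [dotProduct, sq]

lemma continuous_covDensity : Continuous fun s ↦ expNeg A s * σ * σᵀ * expNeg Aᵀ s :=
  (((continuous_expNeg A).matrix_mul continuous_const).matrix_mul continuous_const).matrix_mul
    (continuous_expNeg Aᵀ)

lemma covAt_eq {t : ℝ} (ht : 0 ≤ t) :
    covAt A σ t = Matrix.of fun i j ↦ ∫ s, (expNeg A s * σ * σᵀ * expNeg Aᵀ s) i j
      ∂(volume.restrict (Set.Ioc 0 t)) := by
  simp only [covAt, intervalIntegral.integral_of_le ht]

lemma integrableOn_Ioc_covDensity (t : ℝ) (i j : Fin m) :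
    IntegrableOn (fun s ↦ (expNeg A s * σ * σᵀ * expNeg Aᵀ s) i j) (Set.Ioc 0 t) :=
  ((continuous_covDensity A σ).matrix_elem i j).integrableOn_Ioc

lemma posSemidef_covAt {t : ℝ} (ht : 0 ≤ t) : (covAt A σ t).PosSemidef := by
  rw [covAt_eq A σ ht]
  exact .of_integral (integrableOn_Ioc_covDensity A σ t) (posSemidef_covDensity A σ)

lemma dotProduct_covAt_mulVec {t : ℝ} (ht : 0 ≤ t) (v : EuclideanSpace ℝ (Fin m)) :
    v ⬝ᵥ covAt A σ t *ᵥ v = ∫ s in (0 : ℝ)..t, ‖(σᵀ * expNeg Aᵀ s).toEuclideanLin v‖ ^ 2 := by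
  rw [covAt_eq A σ ht, dotProduct_of_integral_mulVec (integrableOn_Ioc_covDensity A σ t),
    intervalIntegral.integral_of_le ht]
  simp_rw [dotProduct_covDensity_mulVec]

end Covariance

/-! ### The Gaussian law of the solution -/

section Law

open Filter Topology
open scoped RealInnerProductSpace

variable {m n : ℕ}

lemma Matrix.inner_toEuclideanLin (M : Matrix (Fin m) (Fin n) ℝ) (u : EuclideanSpace ℝ (Fin m))
    (w : EuclideanSpace ℝ (Fin n)) :
    ⟪u, M.toEuclideanLin w⟫ = ⟪Mᵀ.toEuclideanLin u, w⟫ := by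
  rw [← Matrix.conjTranspose_eq_transpose_of_trivial,
    Matrix.toEuclideanLin_conjTranspose_eq_adjoint,
    LinearMap.adjoint_inner_left]

lemma Matrix.toEuclideanLin_mul_apply {p : ℕ} (M : Matrix (Fin m) (Fin n) ℝ)
    (N : Matrix (Fin n) (Fin p) ℝ) (v : EuclideanSpace ℝ (Fin p)) :
    (M * N).toEuclideanLin v = M.toEuclideanLin (N.toEuclideanLin v) := by
  simp [Matrix.toLpLin_apply]

section

attribute [local instance] Matrix.linftyOpNormedRing Matrix.linftyOpNormedAlgebra

lemma hasDerivAt_expNeg_apply (A : Matrix (Fin m) (Fin m) ℝ) (v : EuclideanSpace ℝ (Fin m))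
    (t : ℝ) :
    HasDerivAt (fun s ↦ (expNeg A s).toEuclideanLin v)
      (-A.toEuclideanLin ((expNeg A t).toEuclideanLin v)) t := by
  let Φ : Matrix (Fin m) (Fin m) ℝ →ₗ[ℝ] EuclideanSpace ℝ (Fin m) :=
    (LinearMap.applyₗ v).comp (Matrix.toEuclideanLin (𝕜 := ℝ) (m := Fin m) (n := Fin m)).toLinearMap
  have h := (LinearMap.toContinuousLinearMap Φ).hasFDerivAt.comp_hasDerivAt t
    (hasDerivAt_expNeg A t)
  have hΦ : Φ (-(A * expNeg A t)) = -A.toEuclideanLin ((expNeg A t).toEuclideanLin v) := by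
    rw [map_neg, ← Matrix.toEuclideanLin_mul_apply]
    rfl
  rw [← hΦ]
  exact h

end

/-- Reversing time flips the sign of the generator, so this curve is the `h` of the duality
argument. -/
lemma hasDerivAt_expNeg_transpose_sub (A : Matrix (Fin m) (Fin m) ℝ)
    (v : EuclideanSpace ℝ (Fin m)) (t s : ℝ) :
    HasDerivAt (fun s ↦ (expNeg Aᵀ (t - s)).toEuclideanLin v)
      ((Matrix.toEuclideanCLM (𝕜 := ℝ) A).adjoint ((expNeg Aᵀ (t - s)).toEuclideanLin v)) s := by
  have h := (hasDerivAt_expNeg_apply Aᵀ v (t - s)).scomp s ((hasDerivAt_id s).const_sub t)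
  have hadj : (Matrix.toEuclideanCLM (𝕜 := ℝ) A).adjoint = Matrix.toEuclideanCLM (𝕜 := ℝ) Aᵀ := by
    rw [← Matrix.conjTranspose_eq_transpose_of_trivial, ← ContinuousLinearMap.star_eq_adjoint,
      ← map_star, Matrix.star_eq_conjTranspose]
  rw [hadj]
  simp only [neg_smul, one_smul, neg_neg] at h
  exact h

variable {Ω : Type*} [MeasurableSpace Ω] {P : Measure Ω}
  {A : Matrix (Fin m) (Fin m) ℝ} {σ : Matrix (Fin m) (Fin n) ℝ}
  {B : ℝ≥0 → Ω → EuclideanSpace ℝ (Fin n)} {x : EuclideanSpace ℝ (Fin m)}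
  {X : ℝ≥0 → Ω → EuclideanSpace ℝ (Fin m)}

/-- Duality with the adjoint equation writes `⟪v, X t⟫` as a limit of Wiener integrals of step
functions. -/
lemma IsOUSolution.ae_tendsto_sum (hB : IsStdBrownian B P) (hX : IsOUSolution A σ B P x X)
    (t : ℝ≥0) (v : EuclideanSpace ℝ (Fin m)) :
    ∀ᵐ ω ∂P, Tendsto (fun N : ℕ ↦ ∑ k ∈ Finset.range N,
      ⟪(σᵀ * expNeg Aᵀ (t - k * (t / N))).toEuclideanLin v,
        B (((k + 1 : ℕ) : ℝ≥0) * (t / N)) ω - B (k * (t / N)) ω⟫) atTop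
      (𝓝 (⟪v, X t ω⟫ - ⟪v, (expNeg A t).toEuclideanLin x⟫)) := by
  filter_upwards [hX.continuous_paths, hX.equation, hB.ae_eval_zero] with ω hc he h0
  have heq (s : ℝ) (hs : 0 ≤ s) : X s.toNNReal ω = x - (∫ r in (0 : ℝ)..s,
      Matrix.toEuclideanCLM (𝕜 := ℝ) A (X r.toNNReal ω)) + σ.toEuclideanLin (B s.toNNReal ω) := by
    have := he s.toNNReal
    rw [Real.coe_toNNReal s hs] at this
    exact this
  have h := tendsto_sum_inner_increment (Y := fun s ↦ X s.toNNReal ω)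
    (W := fun s ↦ σ.toEuclideanLin (B s.toNNReal ω)) (hc.comp continuous_real_toNNReal)
    (hasDerivAt_expNeg_transpose_sub A v t) heq t.coe_nonneg
  have hX0 : X 0 ω = x := by simpa [h0] using he 0
  have hv : ⟪(expNeg Aᵀ t).toEuclideanLin v, x⟫ = ⟪v, (expNeg A t).toEuclideanLin x⟫ := by
    rw [Matrix.inner_toEuclideanLin, expNeg_transpose]
  have hE0 : expNeg Aᵀ 0 = 1 := by simp [expNeg]
  simp only [sub_self, sub_zero, Real.toNNReal_coe, Real.toNNReal_zero, hX0, hv, hE0,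
    Matrix.toLpLin_one, LinearMap.id_apply] at h
  refine h.congr fun N ↦ Finset.sum_congr rfl fun k _ ↦ ?_
  have hτ (k : ℕ) : ((k : ℝ) * (t / N)).toNNReal = k * (t / N) := by
    rw [← Real.toNNReal_coe (r := k * (t / N))]
    push_cast
    rfl
  rw [hτ, hτ, ← map_sub, Matrix.inner_toEuclideanLin, ← Matrix.toEuclideanLin_mul_apply]

/-- The solution of the linear equation with additive Brownian noise is Gaussian. -/
theorem IsOUSolution.map_eq [IsProbabilityMeasure P] (hB : IsStdBrownian B P)
    (hX : IsOUSolution A σ B P x X) (t : ℝ≥0) :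
    P.map (X t) = multivariateGaussian ((expNeg A t).toEuclideanLin x) (covAt A σ t) := by
  have := Measure.isProbabilityMeasure_map (hX.aemeasurable t)
  refine Measure.ext_of_charFun ?_
  ext v
  set a := (expNeg A t).toEuclideanLin x
  let g (N k : ℕ) := (σᵀ * expNeg Aᵀ (t - k * (t / N))).toEuclideanLin v
  let R (N : ℕ) (ω : Ω) : ℝ := ∑ k ∈ Finset.range N,
    ⟪g N k, B (((k + 1 : ℕ) : ℝ≥0) * (t / N)) ω - B (k * (t / N)) ω⟫
  have hτ (N : ℕ) : Monotone fun k : ℕ ↦ (k : ℝ≥0) * (t / N) :=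
    fun i j hij ↦ by dsimp only; gcongr
  have hchar (N : ℕ) : ∫ ω, Complex.exp ((R N ω : ℂ) * Complex.I) ∂P =
      Complex.exp (-((∑ k ∈ Finset.range N, (t : ℝ) / N * ‖g N k‖ ^ 2 : ℝ) : ℂ) / 2) := by
    have h := hB.integral_exp_sum_inner_increment (hτ N) (g N) N
    have hd (k : ℕ) : (((((k + 1 : ℕ) : ℝ≥0) * (t / N) : ℝ≥0) : ℝ) -
        (((k : ℝ≥0) * (t / N) : ℝ≥0) : ℝ)) = (t : ℝ) / N := by
      push_cast
      ring
    simp_rw [hd] at h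
    exact h
  have hR (N : ℕ) : AEMeasurable (R N) P := Finset.aemeasurable_fun_sum _ fun k _ ↦
    (innerSL ℝ (g N k)).continuous.measurable.comp_aemeasurable
      ((hB.aemeasurable _).sub (hB.aemeasurable _))
  have hf : Continuous fun s : ℝ ↦ ‖(σᵀ * expNeg Aᵀ s).toEuclideanLin v‖ ^ 2 := by
    have : Continuous fun s : ℝ ↦ (expNeg Aᵀ s).toEuclideanLin v :=
      continuous_iff_continuousAt.2 fun s ↦ (hasDerivAt_expNeg_apply Aᵀ v s).continuousAt
    simp_rw [Matrix.toEuclideanLin_mul_apply]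
    exact ((LinearMap.continuous_of_finiteDimensional _).comp this).norm.pow 2
  have hvar : Tendsto (fun N : ℕ ↦ ∑ k ∈ Finset.range N, (t : ℝ) / N * ‖g N k‖ ^ 2) atTop
      (𝓝 (v ⬝ᵥ covAt A σ t *ᵥ v)) := by
    -- The sums sample the density at `t - s`; the substitution `s ↦ t - s` recovers `Σ_t`.
    have h := tendsto_riemannSum t.coe_nonneg (hf.comp (continuous_const.sub continuous_id :
      Continuous fun s : ℝ ↦ (t : ℝ) - s))
    have h2 := intervalIntegral.integral_comp_sub_left (a := 0) (b := t)
      (fun s : ℝ ↦ ‖(σᵀ * expNeg Aᵀ s).toEuclideanLin v‖ ^ 2) t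
    rw [sub_self, sub_zero, ← dotProduct_covAt_mulVec A σ t.coe_nonneg] at h2
    rw [← h2]
    exact h
  have hlim1 : Tendsto (fun N ↦ ∫ ω, Complex.exp ((R N ω : ℂ) * Complex.I) ∂P) atTop
      (𝓝 (Complex.exp (-((v ⬝ᵥ covAt A σ t *ᵥ v : ℝ) : ℂ) / 2))) := by
    simp_rw [hchar]
    exact (Complex.continuous_exp.tendsto _).comp
      (((Complex.continuous_ofReal.tendsto _).comp hvar).neg.div_const 2)
  have hlim2 : Tendsto (fun N ↦ ∫ ω, Complex.exp ((R N ω : ℂ) * Complex.I) ∂P) atTop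
      (𝓝 (∫ ω, Complex.exp (((⟪v, X t ω⟫ - ⟪v, a⟫ : ℝ) : ℂ) * Complex.I) ∂P)) := by
    refine tendsto_integral_of_dominated_convergence (fun _ ↦ 1) (fun N ↦ ?_)
      (integrable_const _) (fun N ↦ ae_of_all _ fun ω ↦ ?_) ?_
    · exact (by fun_prop : Continuous fun r : ℝ ↦ Complex.exp ((r : ℂ) * Complex.I))
        |>.measurable.comp_aemeasurable (hR N) |>.aestronglyMeasurable
    · rw [Complex.norm_exp_ofReal_mul_I]
    · filter_upwards [hX.ae_tendsto_sum hB t v] with ω hω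
      exact ((by fun_prop : Continuous fun r : ℝ ↦ Complex.exp ((r : ℂ) * Complex.I)).tendsto
        _).comp hω
  -- The pathwise limit and the explicit Gaussian formula compute the same limit of expectations.
  have heq := tendsto_nhds_unique hlim2 hlim1
  rw [charFun_multivariateGaussian (posSemidef_covAt A σ t.coe_nonneg), charFun_apply,
    integral_map (hX.aemeasurable t) (by fun_prop), sub_eq_add_neg, Complex.exp_add, ← neg_div,
    ← heq, ← integral_const_mul]
  refine integral_congr_ae (ae_of_all _ fun ω ↦ ?_)
  dsimp only
  rw [← Complex.exp_add, real_inner_comm]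
  push_cast
  ring_nf

end Law

/-! ### Convergence as `t → ∞` and the stationary law -/

section Stationary

open Filter Topology
open scoped RealInnerProductSpace

variable {m n : ℕ} {A : Matrix (Fin m) (Fin m) ℝ}

section

attribute [local instance] Matrix.linftyOpNormedRing Matrix.linftyOpNormedAlgebra

lemma tendsto_expNeg (hA : HasPositiveSpectrum A) : Tendsto (expNeg A) atTop (𝓝 0) := by
  obtain ⟨C, c, hc, h⟩ := exists_norm_expNeg_le hA
  refine squeeze_zero_norm' (eventually_atTop.2 ⟨0, h⟩) ?_
  have : Tendsto (fun t : ℝ ↦ -c * t) atTop atBot :=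
    tendsto_id.const_mul_atTop_of_neg (neg_lt_zero.2 hc)
  simpa using (Real.tendsto_exp_atBot.comp this).const_mul C

lemma integrableOn_Ioi_covDensity (hA : HasPositiveSpectrum A) (σ : Matrix (Fin m) (Fin n) ℝ)
    (i j : Fin m) :
    IntegrableOn (fun s ↦ (expNeg A s * σ * σᵀ * expNeg Aᵀ s) i j) (Set.Ioi 0) := by
  obtain ⟨C, c, hc, h⟩ := exists_norm_expNeg_le hA
  have hentry (s : ℝ) (hs : 0 ≤ s) (i j : Fin m) : |expNeg A s i j| ≤ C * Real.exp (-c * s) :=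
    (Matrix.abs_apply_le_linfty_opNorm _ i j).trans (h s hs)
  have hC : 0 ≤ C := by simpa using (norm_nonneg _).trans (h 0 le_rfl)
  -- Each entry of the density is a double sum whose terms contain two entries of `e^{-As}`, each at
  -- most `C e^{-cs}`; hence `C²` here and the rate `2c` below.
  let K := ∑ k, ∑ l, |(σ * σᵀ) l k| * C ^ 2
  have hint : IntegrableOn (fun s : ℝ ↦ K * Real.exp (-(2 * c) * s)) (Set.Ioi 0) :=
    (exp_neg_integrableOn_Ioi 0 (by positivity : 0 < 2 * c)).const_mul K
  refine hint.mono' ((continuous_covDensity A σ).matrix_elem i j).aestronglyMeasurable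
    ((ae_restrict_iff' measurableSet_Ioi).2 (ae_of_all _ fun s hs ↦ ?_))
  have hs0 : 0 ≤ s := (Set.mem_Ioi.1 hs).le
  have hexp : Real.exp (-(2 * c) * s) = Real.exp (-c * s) ^ 2 := by
    rw [← Real.exp_nat_mul]
    push_cast
    ring_nf
  rw [Matrix.mul_assoc (expNeg A s), Matrix.mul_apply, Finset.sum_mul]
  refine norm_sum_le_of_le _ fun k _ ↦ ?_
  rw [Matrix.mul_apply, Finset.sum_mul, Finset.sum_mul]
  refine norm_sum_le_of_le _ fun l _ ↦ ?_
  rw [expNeg_transpose, Matrix.transpose_apply, Real.norm_eq_abs, abs_mul, abs_mul, hexp]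
  calc |expNeg A s i l| * |(σ * σᵀ) l k| * |expNeg A s j k|
      ≤ (C * Real.exp (-c * s)) * |(σ * σᵀ) l k| * (C * Real.exp (-c * s)) := by
        gcongr
        exacts [hentry s hs0 i l, hentry s hs0 j k]
    _ = _ := by ring

end

lemma posSemidef_covInfty (hA : HasPositiveSpectrum A) (σ : Matrix (Fin m) (Fin n) ℝ) :
    (covInfty A σ).PosSemidef :=
  .of_integral (integrableOn_Ioi_covDensity hA σ) (posSemidef_covDensity A σ)

lemma tendsto_covAt (hA : HasPositiveSpectrum A) (σ : Matrix (Fin m) (Fin n) ℝ) :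
    Tendsto (covAt A σ) atTop (𝓝 (covInfty A σ)) := by
  refine tendsto_pi_nhds.2 fun i ↦ tendsto_pi_nhds.2 fun j ↦ ?_
  exact intervalIntegral_tendsto_integral_Ioi 0 (integrableOn_Ioi_covDensity hA σ i j) tendsto_id

lemma multivariateGaussian_eq_map_const_add (a : EuclideanSpace ℝ (Fin m))
    (S : Matrix (Fin m) (Fin m) ℝ) :
    multivariateGaussian a S = (multivariateGaussian 0 S).map (a + ·) := by
  rw [multivariateGaussian, multivariateGaussian, Measure.map_map (by fun_prop) (by fun_prop)]
  congr 1
  ext1 z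
  simp

variable {Ω : Type*} [MeasurableSpace Ω] {P : Measure Ω} [IsProbabilityMeasure P]
  {σ : Matrix (Fin m) (Fin n) ℝ} {B : ℝ≥0 → Ω → EuclideanSpace ℝ (Fin n)}
  {X : EuclideanSpace ℝ (Fin m) → ℝ≥0 → Ω → EuclideanSpace ℝ (Fin m)}
  {μ : Measure (EuclideanSpace ℝ (Fin m))}

/-- The starting point enters the law of `X_t(x)` only through the shift by `e^{-At} x`, so
averaging over `μ` is a convolution. -/
lemma IsStationaryLaw.eq_conv (hB : IsStdBrownian B P) (hX : ∀ x, IsOUSolution A σ B P x (X x))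
    (hμ : IsStationaryLaw P X μ) (t : ℝ≥0) :
    μ = (μ.map (expNeg A t).toEuclideanLin) ∗ multivariateGaussian 0 (covAt A σ t) := by
  have hL : Measurable (expNeg A t).toEuclideanLin :=
    (LinearMap.continuous_of_finiteDimensional _).measurable
  ext S hS
  rw [← hμ t S hS, Measure.conv, Measure.map_apply measurable_add hS,
    Measure.prod_apply (measurable_add hS), lintegral_map (measurable_measure_prodMk_left
      (measurable_add hS)) hL]
  refine lintegral_congr fun x ↦ ?_
  rw [(hX x).map_eq hB, multivariateGaussian_eq_map_const_add, Measure.map_apply (by fun_prop) hS]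
  rfl

variable [IsProbabilityMeasure μ]

lemma IsStationaryLaw.charFun_eq (hB : IsStdBrownian B P)
    (hX : ∀ x, IsOUSolution A σ B P x (X x)) (hμ : IsStationaryLaw P X μ) (t : ℝ≥0)
    (v : EuclideanSpace ℝ (Fin m)) :
    charFun μ v = charFun μ ((expNeg A t)ᵀ.toEuclideanLin v) *
      Complex.exp (-((v ⬝ᵥ covAt A σ t *ᵥ v : ℝ) : ℂ) / 2) := by
  have hL : Measurable (expNeg A t).toEuclideanLin :=
    (LinearMap.continuous_of_finiteDimensional _).measurable
  have := Measure.isProbabilityMeasure_map (μ := μ) hL.aemeasurable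
  conv_lhs => rw [hμ.eq_conv hB hX t, charFun_conv,
    charFun_multivariateGaussian (posSemidef_covAt A σ t.coe_nonneg), charFun_apply,
    integral_map hL.aemeasurable (by fun_prop)]
  rw [charFun_apply]
  congr 1
  · refine integral_congr_ae (ae_of_all _ fun x ↦ ?_)
    dsimp only
    rw [real_inner_comm, Matrix.inner_toEuclideanLin, real_inner_comm]
  · simp [neg_div]

/-- The stationary law is unique, and Gaussian. -/
theorem IsStationaryLaw.eq_multivariateGaussian (hA : HasPositiveSpectrum A)
    (hB : IsStdBrownian B P) (hX : ∀ x, IsOUSolution A σ B P x (X x))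
    (hμ : IsStationaryLaw P X μ) : μ = multivariateGaussian 0 (covInfty A σ) := by
  refine Measure.ext_of_charFun ?_
  ext v
  have hcoe : Tendsto (fun t : ℝ≥0 ↦ (t : ℝ)) atTop atTop := NNReal.tendsto_coe_atTop.2 tendsto_id
  have h1 : Tendsto (fun t : ℝ≥0 ↦ (expNeg A t)ᵀ.toEuclideanLin v) atTop (𝓝 0) := by
    have hc : Continuous fun M : Matrix (Fin m) (Fin m) ℝ ↦ Mᵀ.toEuclideanLin v := by
      simp_rw [Matrix.toLpLin_apply]
      fun_prop
    have h := (hc.tendsto 0).comp ((tendsto_expNeg hA).comp hcoe)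
    rw [Matrix.transpose_zero, map_zero, LinearMap.zero_apply] at h
    exact h
  have h2 : Tendsto (fun t : ℝ≥0 ↦ v ⬝ᵥ covAt A σ t *ᵥ v) atTop
      (𝓝 (v ⬝ᵥ covInfty A σ *ᵥ v)) := by
    have hc : Continuous fun M : Matrix (Fin m) (Fin m) ℝ ↦ v ⬝ᵥ M *ᵥ v := by fun_prop
    exact (hc.tendsto _).comp ((tendsto_covAt hA σ).comp hcoe)
  have h3 := (((continuous_charFun (μ := μ)).tendsto 0).comp h1).mul
    ((Complex.continuous_exp.tendsto _).comp
      (((Complex.continuous_ofReal.tendsto _).comp h2).neg.div_const 2))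
  -- The left side of `charFun_eq` does not depend on `t`, so it equals the limit of the right side.
  have h4 := tendsto_nhds_unique
    ((tendsto_const_nhds (x := charFun μ v)).congr fun t ↦ hμ.charFun_eq hB hX t v) h3
  rw [h4, charFun_multivariateGaussian (posSemidef_covInfty hA σ)]
  simp [neg_div]

end Stationary

theorem corollary2 {Ω : Type*} [MeasurableSpace Ω] (P : Measure Ω) [IsProbabilityMeasure P]
    (m n : ℕ) (A : Matrix (Fin m) (Fin m) ℝ) (hA : HasPositiveSpectrum A)
    (σ : Matrix (Fin m) (Fin n) ℝ)
    (B : ℝ≥0 → Ω → EuclideanSpace ℝ (Fin n)) (hB : IsStdBrownian B P)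
    (X : EuclideanSpace ℝ (Fin m) → ℝ≥0 → Ω → EuclideanSpace ℝ (Fin m))
    (hX : ∀ x, IsOUSolution A σ B P x (X x))
    (μ : Measure (EuclideanSpace ℝ (Fin m))) [IsProbabilityMeasure μ] (hμ : IsStationaryLaw P X μ)
    (t : ℝ≥0) (x : EuclideanSpace ℝ (Fin m)) :
    wasserstein 2 (P.map (X x t)) μ =
        wasserstein 2
          (multivariateGaussian ((expNeg A t).toEuclideanLin x) (covAt A σ t))
          (multivariateGaussian 0 (covInfty A σ)) ∧
      wasserstein 2 (P.map (X x t)) μ ≤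
        ENNReal.ofReal (√(‖(expNeg A t).toEuclideanLin x‖ ^ 2 +
          frobeniusSq (CFC.sqrt (covAt A σ t) - CFC.sqrt (covInfty A σ)))) ∧
      wasserstein 2 (P.map (X x t)) μ ≤
        ENNReal.ofReal (√(‖(expNeg A t).toEuclideanLin x‖ ^ 2 +
          m * frobeniusSq (CFC.sqrt (covAt A σ t) - CFC.sqrt (covInfty A σ)))) ∧
      (Commute (covAt A σ t) (covInfty A σ) →
        wasserstein 2 (P.map (X x t)) μ =
          ENNReal.ofReal (√(‖(expNeg A t).toEuclideanLin x‖ ^ 2 +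
            frobeniusSq (CFC.sqrt (covAt A σ t) - CFC.sqrt (covInfty A σ))))) := by
  have hlaw := (hX x).map_eq hB t
  have hstat := hμ.eq_multivariateGaussian hA hB hX
  have hle := wasserstein_multivariateGaussian_le ((expNeg A t).toEuclideanLin x) 0 (covAt A σ t)
    (covInfty A σ)
  rw [sub_zero] at hle
  rw [hlaw, hstat]
  refine ⟨rfl, hle, hle.trans ?_, fun h ↦ ?_⟩
  · gcongr
    -- The factor `m` only weakens the bound when `m ≥ 1`; for `m = 0` the Frobenius sum is empty.
    rcases m.eq_zero_or_pos with rfl | hm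
    · simp [frobeniusSq]
    · exact le_mul_of_one_le_left (frobeniusSq_nonneg _) (by exact_mod_cast hm)
  · have := wasserstein_multivariateGaussian_eq_of_commute ((expNeg A t).toEuclideanLin x) 0
      (posSemidef_covAt A σ t.coe_nonneg) (posSemidef_covInfty hA σ) h
    rwa [sub_zero] at this
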